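/- Let $n\ge 0$, $m\ge 1$ be integers, $H$ a complex Hilbert space and $T=(T_1,\dots,T_n)\in L(H)^n$ a commuting tuple. Put $\sigma_T(X)=\sum_{i=1}^n T_iXT_i^*$ and $\Delta_T^{(k)}=(1-\sigma_T)^k(1_H)$. Assume that $T$ is an $m$-hypercontraction, i.e. $\Delta_T^{(1)}\ge 0$ and $\Delta_T^{(m)}\ge 0$, and that $T$ is pure, i.e. $\sigma_T^k(1_H)\to 0$ strongly as $k\to\infty$. Let $C=(\Delta_T^{(m)})^{1/2}$, $\mathcal D=\overline{CH}$, $\gamma_\alpha=|\alpha|!/\alpha!$ and $\rho_m(\alpha)=\frac{(m+|\alpha|-1)!}{\alpha!\,(m-1)!}$ for $\alpha\in\mathbb N^n$. Let $\mathbb B\subset\mathbb C^n$ be the open Euclidean unit ball, and let $H_m(\mathbb B,\mathcal D)$ be the Hilbert space of analytic functions $f=\sum_\alpha f_\alpha z^\alpha:\mathbb B\to\mathcal D$ with $\|f\|^2=\sum_\alpha\|f_\alpha\|^2/\rho_m(\alpha)<\infty$, whose reproducing kernel is $(1-\langle z,w\rangle)^{-m}1_{\mathcal D}$. Let $M_z=(M_{z_1},\dots,M_{z_n})$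 be the tuple of multiplication operators by the coordinate functions on $H_m(\mathbb B,\mathcal D)$, regarded also as the row operator $M_z:H_m(\mathbb B,\mathcal D)^n\to H_m(\mathbb B,\mathcal D)$, $(h_i)\mapsto\sum_i M_{z_i}h_i$, with adjoint $M_z^*f=(M_{z_i}^*f)_{i=1}^n$. The operator $M_z^*M_z:\operatorname{Im}M_z^*\to\operatorname{Im}M_z^*$ is bijective; $(M_z^*M_z)^{-1}$ denotes its inverse. Then the formula $j(x)(z)=\sum_{\alpha}\rho_m(\alpha)(CT^{*\alpha}x)z^\alpha$ ($x\in H$, $z\in\mathbb B$) defines a linear isometry $j:H\to H_m(\mathbb B,\mathcal D)$, and the space $M=(\operatorname{Im}j)^\perp$ is invariant under $M_{z_1},\dots,M_{z_n}$. A function $f\in H_m(\mathbb B,\mathcal D)$ belongs to the wandering subspace $W(M)=M\ominus\big(\sum_{i=1}^n M_{z_i}M\big)$ if and only if $$f=f_0+M_z(M_z^*M_z)^{-1}(jx_i)_{i=1}^n$$ for some vectors $f_0\in\mathcal D$ and $x_1,\dots,x_n\in H$ with $(jx_i)_{i=1}^n\in M_z^*H_m(\mathbb B,\mathcal D)$ and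 $$Cf_0+\sum_{i=1}^n T_i\Big(\sum_{k=0}^{m-1}(-1)^k\binom{m}{k+1}\sum_{|\alpha|=k}\gamma_\alpha T^\alpha T^{*\alpha}x_i\Big)=0.$$ In this case, for every such representation, $(jx_i)_{i=1}^n=M_z^*f$. -/

import Mathlib

namespace BergmanBall

open scoped InnerProductSpace ComplexConjugate Topology

noncomputable section

/-- The open Euclidean unit ball of `ℂⁿ`. -/
abbrev Ball (n : ℕ) : Type := Metric.ball (0 : EuclideanSpace ℂ (Fin n)) 1

/-- The weight `ρ_m(α) = (m + |α| - 1)! / (α! (m - 1)!)`, for `m ≥ 1`. -/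
def rho {n : ℕ} (m : ℕ) (α : Fin n → ℕ) : ℝ :=
  ((m + ∑ i, α i - 1).factorial : ℝ) / ((∏ i, (α i).factorial : ℕ) * (m - 1).factorial)

/-- The monomial `z ^ α`. -/
def monomial {n : ℕ} (z : Fin n → ℂ) (α : Fin n → ℕ) : ℂ := ∏ i, z i ^ α i

theorem rho_pos {n : ℕ} (m : ℕ) (α : Fin n → ℕ) : 0 < rho m α := by
  unfold rho; positivity

theorem rho_eq {n : ℕ} (m : ℕ) [NeZero m] (α : Fin n → ℕ) :
    rho m α = ((∑ i, α i) + (m - 1)).choose (m - 1) * Nat.multinomial Finset.univ α := by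
  obtain ⟨k, rfl⟩ := Nat.exists_eq_succ_of_ne_zero (NeZero.ne m)
  have h1 := Nat.multinomial_spec Finset.univ α
  have h2 := Nat.add_choose_mul_factorial_mul_factorial (∑ i, α i) k
  have h3 : k.succ + ∑ i, α i - 1 = ∑ i, α i + k := by omega
  unfold rho
  rw [h3, Nat.succ_sub_one, div_eq_iff (by positivity), ← h2, ← h1,
    ← Nat.choose_symm_add]
  push_cast
  ring

theorem rho_add_single {n : ℕ} (m : ℕ) [NeZero m] (α : Fin n → ℕ) (i : Fin n) :
    rho m (α + Pi.single i 1) * (α i + 1) = rho m α * (m + ∑ i, α i) := by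
  obtain ⟨k, rfl⟩ := Nat.exists_eq_succ_of_ne_zero (NeZero.ne m)
  have h1 : ∑ j, (α + Pi.single i 1 : Fin n → ℕ) j = ∑ j, α j + 1 := by
    simp [Finset.sum_add_distrib]
  have h2 : ∏ j, ((α + Pi.single i 1 : Fin n → ℕ) j).factorial = (∏ j, (α j).factorial) * (α i + 1) := by
    rw [← Finset.mul_prod_erase _ _ (Finset.mem_univ i),
      ← Finset.mul_prod_erase _ (fun j => (α j).factorial) (Finset.mem_univ i)]
    have : ∏ j ∈ Finset.univ.erase i, ((α + Pi.single i 1 : Fin n → ℕ) j).factorial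
        = ∏ j ∈ Finset.univ.erase i, (α j).factorial :=
      Finset.prod_congr rfl fun j hj => by simp [Finset.ne_of_mem_erase hj]
    rw [this]
    simp [Nat.factorial_succ]
    ring
  unfold rho
  rw [h1, h2, show k.succ + (∑ j, α j + 1) - 1 = (k + ∑ j, α j) + 1 by omega,
    show k.succ + (∑ j, α j) - 1 = k + ∑ j, α j by omega, Nat.factorial_succ]
  push_cast
  field_simp
  ring

theorem monomial_add_single {n : ℕ} (z : Fin n → ℂ) (α : Fin n → ℕ) (i : Fin n) :
    monomial z (α + Pi.single i 1) = z i * monomial z α := by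
  unfold monomial
  simp only [Pi.add_apply, pow_add, Finset.prod_mul_distrib]
  rw [mul_comm]
  congr 1
  rw [Finset.prod_eq_single i] <;> simp +contextual

/-- The multi-indices of degree `k`, as a finite set. -/
def degreeEquiv (n k : ℕ) :
    {α : Fin n → ℕ // ∑ i, α i = k} ≃ (Finset.piAntidiag (Finset.univ : Finset (Fin n)) k) :=
  Equiv.subtypeEquivRight (by simp)

theorem hasSum_degree {n : ℕ} (m : ℕ) [NeZero m] (u : Fin n → ℂ) (k : ℕ) :
    HasSum (fun α : {α : Fin n → ℕ // ∑ i, α i = k} => (rho m α.1 : ℂ) * monomial u α.1)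
      (((k + (m - 1)).choose (m - 1) : ℂ) * (∑ i, u i) ^ k) := by
  rw [← (degreeEquiv n k).symm.hasSum_iff, Finset.sum_pow_eq_sum_piAntidiag, Finset.mul_sum]
  have := Finset.hasSum (Finset.piAntidiag (Finset.univ : Finset (Fin n)) k)
    (fun α => ((k + (m - 1)).choose (m - 1) : ℂ) *
      ((Nat.multinomial Finset.univ α : ℂ) * ∏ i, u i ^ α i))
  convert! this using 1
  ext α
  have hα : ∑ i, α.1 i = k := ((degreeEquiv n k).symm α).2
  simp only [Function.comp_apply, degreeEquiv, Equiv.subtypeEquivRight_symm_apply_coe, rho_eq,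
    hα, monomial]
  push_cast
  ring

theorem summable_norm_rho {n : ℕ} (m : ℕ) [NeZero m] (u : Fin n → ℂ) (hu : ∑ i, ‖u i‖ < 1) :
    Summable fun α : Fin n → ℕ => ‖(rho m α : ℂ) * monomial u α‖ := by
  have key : ∀ k, HasSum (fun α : {α : Fin n → ℕ // ∑ i, α i = k} =>
      ‖(rho m α.1 : ℂ) * monomial u α.1‖)
      (((k + (m - 1)).choose (m - 1) : ℝ) * (∑ i, ‖u i‖) ^ k) := by
    intro k
    have := hasSum_degree m (fun i => (‖u i‖ : ℂ)) k
    rw [← Complex.hasSum_ofReal]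
    convert! this using 1
    · ext α
      simp [monomial, abs_of_pos (rho_pos m _)]
    · push_cast; rfl
  rw [← (Equiv.sigmaFiberEquiv fun α : Fin n → ℕ => ∑ i, α i).summable_iff]
  refine (summable_sigma_of_nonneg (fun _ => norm_nonneg _)).mpr ?_
  refine ⟨fun k => (key k).summable, ?_⟩
  have h : ‖∑ i, ‖u i‖‖ < 1 := by
    rwa [Real.norm_of_nonneg (Finset.sum_nonneg fun _ _ => norm_nonneg _)]
  convert! summable_choose_mul_geometric_of_norm_lt_one (m - 1) h using 2 with k
  exact (key k).tsum_eq

theorem hasSum_rho {n : ℕ} (m : ℕ) [NeZero m] (u : Fin n → ℂ) (hu : ∑ i, ‖u i‖ < 1) :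
    HasSum (fun α : Fin n → ℕ => (rho m α : ℂ) * monomial u α) (((1 - ∑ i, u i) ^ m)⁻¹) := by
  have hs := (summable_norm_rho m u hu).of_norm
  have h : ‖∑ i, u i‖ < 1 := (norm_sum_le _ _).trans_lt hu
  have h1 := hasSum_choose_mul_geometric_of_norm_lt_one (m - 1) h
  rw [Nat.sub_add_cancel (NeZero.one_le), one_div] at h1
  have h2 := ((Equiv.sigmaFiberEquiv fun α : Fin n → ℕ => ∑ i, α i).hasSum_iff.mpr
    hs.hasSum).sigma (fun k => hasSum_degree m u k)
  exact h2.unique h1 ▸ hs.hasSum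


section Space

variable {n m : ℕ} {E : Type*} [NormedAddCommGroup E] [InnerProductSpace ℂ E]

/-- The Hilbert space `H_m(𝔹, E)` of the functions `f = ∑ f_α z^α` on the unit ball of `ℂⁿ` with
`‖f‖² = ∑ ‖f_α‖² / ρ_m(α) < ∞`. A function is stored through its normalized Taylor coefficients
`f_α / ρ_m(α)^{1/2}`; `coeff` gives back `f_α`, and the `RKHS` instance below turns an element
into an actual function on the ball. -/
def BergmanSpace (n _m : ℕ) (E : Type*) [NormedAddCommGroup E] [InnerProductSpace ℂ E] : Type _ :=
  lp (fun _ : Fin n → ℕ => E) 2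

instance : NormedAddCommGroup (BergmanSpace n m E) :=
  inferInstanceAs (NormedAddCommGroup (lp (fun _ : Fin n → ℕ => E) 2))

instance : InnerProductSpace ℂ (BergmanSpace n m E) :=
  inferInstanceAs (InnerProductSpace ℂ (lp (fun _ : Fin n → ℕ => E) 2))

instance [CompleteSpace E] : CompleteSpace (BergmanSpace n m E) :=
  inferInstanceAs (CompleteSpace (lp (fun _ : Fin n → ℕ => E) 2))

/-- The normalized Taylor coefficients `f_α / ρ_m(α)^{1/2}` of `f`. -/
def normCoeff (f : BergmanSpace n m E) : lp (fun _ : Fin n → ℕ => E) 2 := f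

/-- The Taylor coefficients `f_α` of `f`. -/
def coeff (f : BergmanSpace n m E) (α : Fin n → ℕ) : E := √(rho m α) • normCoeff f α

@[simp] theorem normCoeff_add (f g : BergmanSpace n m E) (α : Fin n → ℕ) :
    normCoeff (f + g) α = normCoeff f α + normCoeff g α := rfl

@[simp] theorem normCoeff_smul (c : ℂ) (f : BergmanSpace n m E) (α : Fin n → ℕ) :
    normCoeff (c • f) α = c • normCoeff f α := rfl

theorem BergmanSpace.ext_coeff {f g : BergmanSpace n m E}
    (h : ∀ α, normCoeff f α = normCoeff g α) : f = g := lp.ext (funext h)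

theorem norm_sq_eq (f : BergmanSpace n m E) : HasSum (fun α => ‖coeff f α‖ ^ 2 / rho m α) (‖f‖ ^ 2) := by
  have h := lp.hasSum_norm (p := 2) (by norm_num) (normCoeff f)
  have h' : HasSum (fun α => ‖normCoeff f α‖ ^ 2) (‖f‖ ^ 2) := by
    have h2 : ‖normCoeff f‖ = ‖f‖ := rfl
    simpa [h2] using h
  convert! h' using 2 with α
  have := rho_pos m α
  rw [coeff, norm_smul, mul_pow, Real.norm_of_nonneg (Real.sqrt_nonneg _), Real.sq_sqrt this.le]
  field_simp

theorem inner_eq (f g : BergmanSpace n m E) :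
    HasSum (fun α => ⟪normCoeff f α, normCoeff g α⟫_ℂ) ⟪f, g⟫_ℂ :=
  lp.hasSum_inner (𝕜 := ℂ) (normCoeff f) (normCoeff g)

/-- The element with a single normalized Taylor coefficient. -/
def single (m : ℕ) (α : Fin n → ℕ) : E →L[ℂ] BergmanSpace n m E :=
  lp.singleContinuousLinearMap ℂ (fun _ : Fin n → ℕ => E) 2 α

theorem normCoeff_single (α β : Fin n → ℕ) (v : E) :
    normCoeff (single m α v) β = if β = α then v else 0 := by
  have : normCoeff (single m α v) β = (Pi.single α v : (Fin n → ℕ) → E) β := rfl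
  rw [this, Pi.single_apply]

theorem inner_single (α : Fin n → ℕ) (v : E) (f : BergmanSpace n m E) :
    ⟪single m α v, f⟫_ℂ = ⟪v, normCoeff f α⟫_ℂ :=
  lp.inner_single_left (𝕜 := ℂ) (G := fun _ : Fin n → ℕ => E) α v (normCoeff f)

theorem sum_norm_sq_lt (z w : Ball n) : ∑ i, ‖conj (w.1 i) * z.1 i‖ < 1 := by
  have hz : ‖z.1‖ < 1 := mem_ball_zero_iff.mp z.2
  have hw : ‖w.1‖ < 1 := mem_ball_zero_iff.mp w.2
  have h1 : ∑ i, ‖w.1 i‖ * ‖z.1 i‖ ≤ ‖w.1‖ * ‖z.1‖ := by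
    rw [EuclideanSpace.norm_eq, EuclideanSpace.norm_eq]
    exact Real.sum_mul_le_sqrt_mul_sqrt _ _ _
  calc ∑ i, ‖conj (w.1 i) * z.1 i‖ = ∑ i, ‖w.1 i‖ * ‖z.1 i‖ := by simp
    _ ≤ ‖w.1‖ * ‖z.1‖ := h1
    _ < 1 := by nlinarith [norm_nonneg z.1, norm_nonneg w.1]

theorem conj_monomial_mul (z w : Fin n → ℂ) (α : Fin n → ℕ) :
    conj (monomial w α) * monomial z α = monomial (fun i => conj (w i) * z i) α := by
  simp [monomial, mul_pow, Finset.prod_mul_distrib]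

theorem memℓp_monomial [NeZero m] (z : Ball n) :
    Memℓp (fun α : Fin n → ℕ => (√(rho m α) : ℂ) * monomial z.1 α) 2 := by
  apply memℓp_gen
  convert! summable_norm_rho m (fun i => conj (z.1 i) * z.1 i) (sum_norm_sq_lt z z) using 2 with α
  rw [← conj_monomial_mul, norm_mul, norm_mul, norm_mul]
  have := rho_pos m α
  simp only [ENNReal.toReal_ofNat, Real.rpow_ofNat, Complex.norm_real, Real.norm_eq_abs,
    abs_of_pos this, abs_of_nonneg (Real.sqrt_nonneg _), mul_pow, Real.sq_sqrt this.le,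
    RCLike.norm_conj]
  ring

/-- The square summable family `(ρ_m(α)^{1/2} z^α)_α`. -/
def monomialLp (m : ℕ) [NeZero m] (z : Ball n) : lp (fun _ : Fin n → ℕ => ℂ) 2 :=
  ⟨_, memℓp_monomial (m := m) z⟩

theorem summable_norm_mul {F G : Type*} [NormedAddCommGroup F] [NormedAddCommGroup G] {ι : Type*}
    (f : lp (fun _ : ι => F) 2) (g : lp (fun _ : ι => G) 2) :
    (Summable fun i => ‖f i‖ * ‖g i‖) ∧ ∑' i, ‖f i‖ * ‖g i‖ ≤ ‖f‖ * ‖g‖ := by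
  have hf := (lp.memℓp f).summable (by norm_num)
  have hg := (lp.memℓp g).summable (by norm_num)
  have h22 : (2 : ℝ).HolderConjugate 2 := by rw [Real.holderConjugate_iff]; norm_num
  have h1 := Real.summable_mul_of_Lp_Lq_of_nonneg h22 (fun i => norm_nonneg (f i))
    (fun i => norm_nonneg (g i)) (by simpa using hf) (by simpa using hg)
  refine ⟨h1, ?_⟩
  have h2 := Real.inner_le_Lp_mul_Lq_tsum_of_nonneg h22 (fun i => norm_nonneg (f i))
    (fun i => norm_nonneg (g i)) (by simpa using hf) (by simpa using hg)
  rw [lp.norm_eq_tsum_rpow (by norm_num), lp.norm_eq_tsum_rpow (by norm_num)]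
  simpa using h2

theorem norm_monomial_smul [NeZero m] (z : Ball n) (f : BergmanSpace n m E) (α : Fin n → ℕ) :
    ‖monomial z.1 α • coeff f α‖ = ‖monomialLp m z α‖ * ‖normCoeff f α‖ := by
  have h : monomialLp m z α = (√(rho m α) : ℂ) * monomial z.1 α := rfl
  rw [coeff, h, norm_smul, norm_smul, norm_mul, Complex.norm_real]
  ring

theorem summable_eval [NeZero m] (z : Ball n) (f : BergmanSpace n m E) :
    Summable fun α => ‖monomial z.1 α • coeff f α‖ := by
  simp_rw [norm_monomial_smul]
  exact (summable_norm_mul (monomialLp m z) (normCoeff f)).1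

/-- Point evaluation `f ↦ f(z) = ∑ f_α z^α`. -/
def evalCLM [CompleteSpace E] [NeZero m] (z : Ball n) : BergmanSpace n m E →L[ℂ] E :=
  LinearMap.mkContinuous
    { toFun := fun f => ∑' α, monomial z.1 α • coeff f α
      map_add' := fun f g => by
        rw [← (summable_eval z f).of_norm.tsum_add (summable_eval z g).of_norm]
        simp [coeff]
      map_smul' := fun c f => by
        rw [RingHom.id_apply, ← (summable_eval z f).of_norm.tsum_const_smul]
        refine tsum_congr fun α => ?_
        simp only [coeff, normCoeff_smul]
        rw [smul_comm c, smul_comm c] }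
    ‖monomialLp m z‖
    fun f => by
      refine (norm_tsum_le_tsum_norm (summable_eval z f)).trans ?_
      simp_rw [norm_monomial_smul]
      exact (summable_norm_mul (monomialLp m z) (normCoeff f)).2

theorem hasSum_evalCLM [CompleteSpace E] [NeZero m] (z : Ball n) (f : BergmanSpace n m E) :
    HasSum (fun α => monomial z.1 α • coeff f α) (evalCLM z f) :=
  (summable_eval z f).of_norm.hasSum

/-- A convergent power series on the ball with sum zero has zero coefficients. -/
theorem coeff_eq_zero (c : (Fin n → ℕ) → ℂ)
    (h : ∀ z : Ball n, HasSum (fun α => monomial z.1 α * c α) 0) (α : Fin n → ℕ) : c α = 0 := by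
  -- homogeneous components vanish on the ball
  have hom : ∀ (k : ℕ) (z : Ball n), ∑ α ∈ Finset.piAntidiag Finset.univ k, monomial z.1 α * c α = 0 := by
    intro k z
    set P : ℕ → ℂ := fun k => ∑ α ∈ Finset.piAntidiag Finset.univ k, monomial z.1 α * c α with hP
    have hs : ∀ t : ℂ, ‖t‖ < 1 → HasSum (fun k => t ^ k * P k) 0 := by
      intro t ht
      have hz : ‖z.1‖ < 1 := mem_ball_zero_iff.mp z.2
      have htz : ‖t • z.1‖ < 1 := by
        rw [norm_smul]; nlinarith [norm_nonneg t, norm_nonneg z.1]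
      have h0 := h ⟨t • z.1, by simpa using htz⟩
      refine (((Equiv.sigmaFiberEquiv fun α : Fin n → ℕ => ∑ i, α i).hasSum_iff.mpr h0).sigma
        (g := fun k => t ^ k * P k) (fun k => ?_))
      rw [← (degreeEquiv n k).symm.hasSum_iff, hP, Finset.mul_sum]
      convert! Finset.hasSum (Finset.piAntidiag (Finset.univ : Finset (Fin n)) k)
        (fun α => t ^ k * (monomial z.1 α * c α)) using 1
      ext α
      have hα : ∑ i, α.1 i = k := ((degreeEquiv n k).symm α).2
      simp only [Function.comp_apply, degreeEquiv, Equiv.subtypeEquivRight_symm_apply_coe,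
        monomial, Equiv.sigmaFiberEquiv, Equiv.coe_fn_mk]
      simp only [PiLp.smul_apply, smul_eq_mul, mul_pow, Finset.prod_mul_distrib]
      rw [Finset.prod_pow_eq_pow_sum, hα]
      ring
    have hF : HasFPowerSeriesOnBall (0 : ℂ → ℂ) (FormalMultilinearSeries.ofScalars ℂ P) 0 1 := by
      refine ⟨?_, by norm_num, ?_⟩
      · refine ENNReal.le_of_forall_nnreal_lt fun r hr => ?_
        refine FormalMultilinearSeries.le_radius_of_summable_norm _ ?_
        have h1 := (hs (r : ℂ) (by simpa using hr)).summable.norm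
        convert! h1 using 2 with k
        simp [mul_comm]
      · intro y hy
        have := hs y (by simpa [← ofReal_norm, ENNReal.ofReal_lt_one] using hy)
        simpa [FormalMultilinearSeries.ofScalars_apply_eq, mul_comm] using this
    have h0 := hF.hasFPowerSeriesAt.eq_zero
    have := congrArg (fun p => FormalMultilinearSeries.coeff p k) h0
    have h2 : P k = 0 := by
      rw [FormalMultilinearSeries.coeff_ofScalars] at this
      exact this.trans (by simp [FormalMultilinearSeries.coeff])
    exact h2
  set k := ∑ i, α i with hk
  let p : MvPolynomial (Fin n) ℂ := ∑ β ∈ Finset.piAntidiag Finset.univ k,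
    MvPolynomial.monomial (Finsupp.equivFunOnFinite.symm β) (c β)
  have hp : p = 0 := by
    refine MvPolynomial.funext_set (fun _ => Metric.ball (0 : ℂ) (1 / (n + 1)))
      (fun _ => infinite_of_mem_nhds 0 (Metric.ball_mem_nhds _ (by positivity))) fun x hx => ?_
    have hx' : ‖WithLp.toLp 2 x‖ < 1 := by
      rw [EuclideanSpace.norm_eq, Real.sqrt_lt' one_pos]
      have : ∀ i, ‖x i‖ ^ 2 ≤ (1 / (n + 1 : ℝ)) ^ 2 := fun i => by
        have := mem_ball_zero_iff.mp (hx i trivial)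
        gcongr
      calc ∑ i, ‖(WithLp.toLp 2 x) i‖ ^ 2 ≤ ∑ _i : Fin n, (1 / (n + 1 : ℝ)) ^ 2 :=
            Finset.sum_le_sum fun i _ => this i
        _ = n / (n + 1 : ℝ) ^ 2 := by simp; ring
        _ < 1 ^ 2 := by
            rw [div_lt_iff₀ (by positivity)]
            have : (0 : ℝ) ≤ n := Nat.cast_nonneg n
            nlinarith
    have := hom k ⟨WithLp.toLp 2 x, mem_ball_zero_iff.mpr hx'⟩
    simp only [p, map_sum, MvPolynomial.eval_monomial, map_zero]
    rw [← this]
    refine Finset.sum_congr rfl fun β _ => ?_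
    rw [Finsupp.prod_fintype _ _ (by simp), mul_comm]
    rfl
  have := congrArg (MvPolynomial.coeff (Finsupp.equivFunOnFinite.symm α)) hp
  simpa [p, MvPolynomial.coeff_sum, MvPolynomial.coeff_monomial, ← hk] using this

theorem coeff_injective [CompleteSpace E] [NeZero m] {f : BergmanSpace n m E}
    (h : ∀ z, evalCLM z f = 0) : f = 0 := by
  refine BergmanSpace.ext_coeff fun α => ?_
  change normCoeff f α = 0
  refine ext_inner_left ℂ fun v => ?_
  have h1 := coeff_eq_zero (fun α => ⟪v, coeff f α⟫_ℂ) (fun z => by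
    have := (hasSum_evalCLM z f).mapL (innerSL ℂ v)
    simpa [h z, inner_smul_right] using this) α
  have h2 : (0 : ℝ) < √(rho m α) := Real.sqrt_pos.mpr (rho_pos m α)
  rw [coeff, ← Complex.coe_smul, inner_smul_right, mul_eq_zero] at h1
  rw [inner_zero_right]
  exact h1.resolve_left (by exact_mod_cast h2.ne')

instance [CompleteSpace E] [NeZero m] : RKHS ℂ (BergmanSpace n m E) (Ball n) E where
  coeCLM := .pi evalCLM
  coeCLM_injective := (injective_iff_map_eq_zero _).mpr fun _ hf =>
    coeff_injective fun z => congrFun hf z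

/-- The value of `f` at `z` is `∑ f_α z^α`. -/
theorem BergmanSpace.hasSum_apply [CompleteSpace E] [NeZero m] (f : BergmanSpace n m E)
    (z : Ball n) : HasSum (fun α => monomial z.1 α • coeff f α) (f z) :=
  hasSum_evalCLM z f

theorem normCoeff_kerFun [CompleteSpace E] [NeZero m] (w : Ball n) (v : E) (α : Fin n → ℕ) :
    normCoeff (RKHS.kerFun (BergmanSpace n m E) w v) α
      = ((√(rho m α) : ℂ) * conj (monomial w.1 α)) • v := by
  refine ext_inner_left ℂ fun u => ?_
  rw [← inner_single (m := m), RKHS.inner_kerFun]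
  have h := (BergmanSpace.hasSum_apply (single m α u) w)
  have h' : HasSum (fun β => monomial w.1 β • coeff (single m α u) β)
      (monomial w.1 α • coeff (single m α u) α) :=
    hasSum_single α fun β hβ => by simp [coeff, normCoeff_single, hβ]
  rw [h.unique h', coeff, normCoeff_single, if_pos rfl, ← Complex.coe_smul]
  simp only [inner_smul_left, inner_smul_right, Complex.conj_ofReal]
  ring

/-- The reproducing kernel of `H_m(𝔹, E)` is `(1 - ⟨z, w⟩)^{-m} 1_E`, where `⟨z, w⟩` is linear in
`z`. -/
theorem kernel_eq [CompleteSpace E] [NeZero m] (z w : Ball n) :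
    RKHS.kernel (BergmanSpace n m E) z w
      = (((1 - ⟪w.1, z.1⟫_ℂ) ^ m)⁻¹ : ℂ) • ContinuousLinearMap.id ℂ E := by
  ext v
  rw [← RKHS.kerFun_apply]
  refine (BergmanSpace.hasSum_apply _ z).unique ?_
  have h := (hasSum_rho m (fun i => conj (w.1 i) * z.1 i) (sum_norm_sq_lt z w)).smul_const v
  have hi : ⟪w.1, z.1⟫_ℂ = ∑ i, conj (w.1 i) * z.1 i := by
    simp [PiLp.inner_apply, mul_comm]
  rw [hi]
  convert! h using 1
  ext α
  rw [coeff, normCoeff_kerFun, ← conj_monomial_mul, ← Complex.coe_smul, smul_smul, smul_smul]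
  congr 1
  have : (√(rho m α) : ℂ) * √(rho m α) = rho m α := by
    rw [← Complex.ofReal_mul, Real.mul_self_sqrt (rho_pos m α).le]
  rw [← this]
  ring

/-- The constant function with value `v`. -/
def constFun (m : ℕ) : E →L[ℂ] BergmanSpace n m E := single m 0

theorem rho_zero : rho m (0 : Fin n → ℕ) = 1 := by
  have : ((m - 1).factorial : ℝ) ≠ 0 := by positivity
  simp [rho, this]

theorem constFun_apply [CompleteSpace E] [NeZero m] (v : E) (z : Ball n) :
    (constFun m v : BergmanSpace n m E) z = v := by
  refine (BergmanSpace.hasSum_apply _ z).unique ?_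
  convert! hasSum_single (f := fun α => monomial z.1 α • coeff (constFun m v) α) 0
    (fun β hβ => by simp [constFun, coeff, normCoeff_single, hβ]) using 1
  simp [constFun, coeff, normCoeff_single, monomial, rho_zero]

theorem backShift_norm_le [NeZero m] (f : BergmanSpace n m E) (i : Fin n) (α : Fin n → ℕ) :
    ‖√(rho m α / rho m (α + Pi.single i 1)) • normCoeff f (α + Pi.single i 1)‖
      ≤ ‖normCoeff f (α + Pi.single i 1)‖ := by
  have h1 := rho_pos m α
  have h2 := rho_pos m (α + Pi.single i 1)
  have h3 := rho_add_single m α i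
  have h4 : (α i : ℝ) ≤ ∑ i, α i := by
    exact_mod_cast Finset.single_le_sum (fun i _ => Nat.zero_le (α i)) (Finset.mem_univ i)
  have h5 : (1 : ℝ) ≤ m := by exact_mod_cast NeZero.one_le (n := m)
  rw [norm_smul, Real.norm_of_nonneg (Real.sqrt_nonneg _)]
  refine mul_le_of_le_one_left (norm_nonneg _) (Real.sqrt_le_one.mpr ?_)
  rw [div_le_one h2]
  push_cast at h3
  have h6 : (0 : ℝ) < α i + 1 := by positivity
  refine le_of_mul_le_mul_right ?_ h6
  rw [h3]
  refine mul_le_mul_of_nonneg_left ?_ h1.le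
  push_cast at h4
  linarith

/-- The backward shift: the Taylor coefficients of `backShift i f` are
`(ρ_m(α) / ρ_m(α + e_i)) f_{α + e_i}`. -/
def backShift [NeZero m] (i : Fin n) : BergmanSpace n m E →L[ℂ] BergmanSpace n m E :=
  have inj : Function.Injective fun α : Fin n → ℕ => α + Pi.single i 1 := add_left_injective _
  have sm (f : BergmanSpace n m E) : Summable fun α => ‖normCoeff f α‖ ^ (2 : ENNReal).toReal :=
    (lp.memℓp (normCoeff f)).summable (by norm_num)
  have le (f : BergmanSpace n m E) (α : Fin n → ℕ) :
      ‖√(rho m α / rho m (α + Pi.single i 1)) • normCoeff f (α + Pi.single i 1)‖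
        ^ (2 : ENNReal).toReal ≤ ‖normCoeff f (α + Pi.single i 1)‖ ^ (2 : ENNReal).toReal :=
    Real.rpow_le_rpow (norm_nonneg _) (backShift_norm_le f i α) (by norm_num)
  have sm' (f : BergmanSpace n m E) := Summable.of_nonneg_of_le
    (fun _ => Real.rpow_nonneg (norm_nonneg _) _) (le f) ((sm f).comp_injective inj)
  LinearMap.mkContinuous
    { toFun := fun f =>
        (⟨fun α => √(rho m α / rho m (α + Pi.single i 1)) • normCoeff f (α + Pi.single i 1),
          memℓp_gen (sm' f)⟩ : lp (fun _ : Fin n → ℕ => E) 2)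
      map_add' := fun f g => lp.ext (funext fun α => smul_add _ _ _)
      map_smul' := fun c f => lp.ext (funext fun α => smul_comm _ _ _) }
    1 fun f => by
      rw [one_mul]
      refine lp.norm_le_of_tsum_le (by norm_num) (norm_nonneg _) ?_
      refine ((sm' f).tsum_le_tsum (le f) ((sm f).comp_injective inj)).trans ?_
      refine (tsum_comp_le_tsum_of_inj (sm f) (fun _ => Real.rpow_nonneg (norm_nonneg _) _)
        inj).trans ?_
      exact (lp.norm_rpow_eq_tsum (by norm_num) (normCoeff f)).ge

theorem normCoeff_backShift [NeZero m] (i : Fin n) (f : BergmanSpace n m E) (α : Fin n → ℕ) :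
    normCoeff (backShift i f) α
      = √(rho m α / rho m (α + Pi.single i 1)) • normCoeff f (α + Pi.single i 1) := rfl

variable [CompleteSpace E] [NeZero m]

/-- The operator `M_{z_i}` of multiplication with the `i`-th coordinate function, obtained as the
adjoint of the backward shift; see `mulCoord_apply` for its action on functions. -/
def mulCoord (i : Fin n) : BergmanSpace n m E →L[ℂ] BergmanSpace n m E :=
  (backShift i).adjoint

theorem adjoint_mulCoord (i : Fin n) :
    (mulCoord i : BergmanSpace n m E →L[ℂ] _).adjoint = backShift i :=
  ContinuousLinearMap.adjoint_adjoint _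

/-- `M_{z_i}` acts as `(M_{z_i} f)(z) = z_i f(z)`. -/
theorem mulCoord_apply (i : Fin n) (f : BergmanSpace n m E) (z : Ball n) :
    (mulCoord i f) z = z.1 i • f z := by
  refine ext_inner_left ℂ fun v => ?_
  rw [← RKHS.kerFun_inner, mulCoord, ContinuousLinearMap.adjoint_inner_right]
  have : backShift i (RKHS.kerFun (BergmanSpace n m E) z v)
      = conj (z.1 i) • RKHS.kerFun (BergmanSpace n m E) z v := by
    refine BergmanSpace.ext_coeff fun α => ?_
    rw [normCoeff_backShift, normCoeff_smul, normCoeff_kerFun, normCoeff_kerFun,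
      monomial_add_single, ← Complex.coe_smul, smul_smul, smul_smul]
    congr 1
    have h2 := rho_pos m (α + Pi.single i 1)
    have : √(rho m α / rho m (α + Pi.single i 1)) * √(rho m (α + Pi.single i 1)) = √(rho m α) := by
      rw [← Real.sqrt_mul (div_nonneg (rho_pos m α).le h2.le), div_mul_cancel₀ _ h2.ne']
    rw [← this]
    push_cast
    rw [map_mul]
    ring
  rw [this, inner_smul_left, RKHS.kerFun_inner, inner_smul_right, Complex.conj_conj]

theorem normCoeff_mulCoord_backShift (i : Fin n) (f : BergmanSpace n m E) (β : Fin n → ℕ) :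
    normCoeff (mulCoord i (backShift i f)) β
      = ((β i : ℝ) / (m + ∑ i, β i - 1)) • normCoeff f β := by
  refine ext_inner_left ℂ fun v => ?_
  rw [← inner_single (m := m), mulCoord, ContinuousLinearMap.adjoint_inner_right]
  by_cases hβ : β i = 0
  · have : backShift i (single m β v) = 0 := by
      refine BergmanSpace.ext_coeff fun α => ?_
      rw [normCoeff_backShift, normCoeff_single, if_neg, smul_zero]
      · rfl
      · rintro rfl
        simp at hβ
    simp [this, hβ]
  · obtain ⟨α, rfl⟩ : ∃ α : Fin n → ℕ, β = α + Pi.single i 1 := by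
      refine ⟨β - Pi.single i 1, ?_⟩
      ext k
      by_cases hk : k = i
      · subst hk; simp; omega
      · simp [hk]
    have h1 : backShift i (single m (α + Pi.single i 1) v)
        = (√(rho m α / rho m (α + Pi.single i 1)) : ℂ) • single m α v := by
      refine BergmanSpace.ext_coeff fun γ => ?_
      rw [normCoeff_backShift, normCoeff_smul, normCoeff_single, normCoeff_single]
      by_cases hγ : γ = α
      · simp [hγ]
      · simp [hγ]
    have h2 := rho_pos m (α + Pi.single i 1)
    have h3 := rho_add_single m α i
    have h4 : (0 : ℝ) < m + ∑ i, α i := by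
      have : (0 : ℝ) < m := by exact_mod_cast Nat.pos_of_ne_zero (NeZero.ne m)
      positivity
    have h5 : ∑ k, ((α + Pi.single i 1 : Fin n → ℕ) k : ℝ) = ∑ k, (α k : ℝ) + 1 := by
      simp [Finset.sum_add_distrib, ← Nat.cast_sum]
    rw [h1, inner_smul_left, inner_single, normCoeff_backShift, ← Complex.coe_smul,
      ← Complex.coe_smul, inner_smul_right, inner_smul_right, ← mul_assoc, Complex.conj_ofReal,
      ← Complex.ofReal_mul, Real.mul_self_sqrt (div_nonneg (rho_pos m α).le h2.le)]
    congr 2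
    rw [div_eq_div_iff h2.ne' (by rw [Nat.cast_sum, h5]; push_cast at h4; linarith), Nat.cast_sum, h5]
    simp only [Pi.add_apply, Pi.single_eq_same]
    push_cast at h3 ⊢
    linarith

end Space

section RowOperators

variable {n : ℕ} {K : Type*} [NormedAddCommGroup K] [InnerProductSpace ℂ K]

/-- The row operator `Kⁿ → K`, `(h_i) ↦ ∑ S_i h_i`, of a tuple `S`, on the Hilbert space sum. -/
def rowOp (S : Fin n → K →L[ℂ] K) : PiLp 2 (fun _ : Fin n => K) →L[ℂ] K :=
  ∑ i, S i ∘L PiLp.proj 2 (fun _ : Fin n => K) i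

theorem rowOp_apply (S : Fin n → K →L[ℂ] K) (h : PiLp 2 (fun _ : Fin n => K)) :
    rowOp S h = ∑ i, S i (h i) := by
  simp [rowOp]

/-- The wandering subspace `W(M) = M ⊖ (∑ S_i M)` of a subspace `M`. -/
def wanderingSubspace (S : Fin n → K →L[ℂ] K) (M : Submodule ℂ K) : Submodule ℂ K :=
  M ⊓ (⨆ i, M.map (S i).toLinearMap)ᗮ

variable [CompleteSpace K]

theorem adjoint_rowOp_apply (S : Fin n → K →L[ℂ] K) (f : K) :
    (rowOp S).adjoint f = WithLp.toLp 2 fun i => (S i).adjoint f := by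
  refine ext_inner_right ℂ fun h => ?_
  rw [ContinuousLinearMap.adjoint_inner_left, rowOp_apply, inner_sum, PiLp.inner_apply]
  simp [ContinuousLinearMap.adjoint_inner_left]

/-- The range `Im S^* ⊆ Kⁿ` of the column operator `S^* : K → Kⁿ`, `f ↦ (S_i^* f)`. -/
def columnRange (S : Fin n → K →L[ℂ] K) : Submodule ℂ (PiLp 2 (fun _ : Fin n => K)) :=
  LinearMap.range (rowOp S).adjoint.toLinearMap

/-- The operator `S^* S : Im S^* → Im S^*`. -/
def gram (S : Fin n → K →L[ℂ] K) : columnRange S →ₗ[ℂ] columnRange S :=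
  ((rowOp S).adjoint ∘L rowOp S).toLinearMap.restrict fun h _ => ⟨rowOp S h, rfl⟩

end RowOperators

section Gram

variable {n m : ℕ} {E : Type*} [NormedAddCommGroup E] [InnerProductSpace ℂ E] [CompleteSpace E]
  [NeZero m]

variable (n m E) in
/-- The multiplication tuple `M_z = (M_{z_1}, …, M_{z_n})` on `H_m(𝔹, E)`. -/
def mulTuple : Fin n → BergmanSpace n m E →L[ℂ] BergmanSpace n m E := fun i => mulCoord i

theorem gram_bijective : Function.Bijective (gram (mulTuple n m E)) := by
  constructor
  · rw [injective_iff_map_eq_zero]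
    rintro ⟨_, g, rfl⟩ h
    have h1 : (rowOp (mulTuple n m E)).adjoint (rowOp (mulTuple n m E)
      ((rowOp (mulTuple n m E)).adjoint g)) = 0 := congrArg Subtype.val h
    have h2 := ContinuousLinearMap.adjoint_inner_right (rowOp (mulTuple n m E))
      ((rowOp (mulTuple n m E)).adjoint g) (rowOp (mulTuple n m E)
      ((rowOp (mulTuple n m E)).adjoint g))
    rw [h1, inner_zero_right, eq_comm, inner_self_eq_zero] at h2
    have h3 := ContinuousLinearMap.adjoint_inner_left (rowOp (mulTuple n m E))
      ((rowOp (mulTuple n m E)).adjoint g) g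
    rw [h2, inner_zero_right, inner_self_eq_zero] at h3
    exact Subtype.ext h3
  · rintro ⟨_, f, rfl⟩
    have hm : (1 : ℝ) ≤ m := by exact_mod_cast NeZero.one_le (n := m)
    let c : (Fin n → ℕ) → ℝ := fun β => (m + ∑ i, β i - 1) / ∑ i, β i
    have hc : ∀ β, ‖c β • normCoeff f β‖ ≤ ‖((m : ℂ) • normCoeff f) β‖ := by
      intro β
      rw [lp.coeFn_smul, Pi.smul_apply, norm_smul, norm_smul]
      refine mul_le_mul_of_nonneg_right ?_ (norm_nonneg _)
      rw [Complex.norm_natCast]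
      rcases Nat.eq_zero_or_pos (∑ i, β i) with h | h
      · simp only [c, h]; simp
      · have h' : (1 : ℝ) ≤ (∑ i, β i : ℕ) := by exact_mod_cast h
        simp only [c]
        rw [Real.norm_of_nonneg (div_nonneg (by linarith) (by linarith)),
          div_le_iff₀ (by linarith)]
        nlinarith
    have hmem : Memℓp (fun β => c β • normCoeff f β) 2 := by
      refine memℓp_gen (Summable.of_nonneg_of_le (fun _ => Real.rpow_nonneg (norm_nonneg _) _)
        (fun β => Real.rpow_le_rpow (norm_nonneg _) (hc β) (by norm_num))
        ((lp.memℓp ((m : ℂ) • normCoeff f)).summable (by norm_num)))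
    let g : BergmanSpace n m E := (⟨_, hmem⟩ : lp (fun _ : Fin n → ℕ => E) 2)
    have hg : ∀ β, normCoeff g β = c β • normCoeff f β := fun _ => rfl
    refine ⟨⟨_, g, rfl⟩, Subtype.ext ?_⟩
    have key : rowOp (mulTuple n m E) ((rowOp (mulTuple n m E)).adjoint g)
        = f - single m 0 (normCoeff f 0) := by
      refine BergmanSpace.ext_coeff fun β => ?_
      have hsum : ∀ (s : Finset (Fin n)) (F : Fin n → BergmanSpace n m E),
          normCoeff (∑ i ∈ s, F i) β = ∑ i ∈ s, normCoeff (F i) β := by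
        intro s F
        induction s using Finset.cons_induction with
        | empty => rfl
        | cons a s ha ih => rw [Finset.sum_cons, Finset.sum_cons, normCoeff_add, ih]
      have hsub : normCoeff (f - single m 0 (normCoeff f 0)) β
          = normCoeff f β - normCoeff (single m 0 (normCoeff f 0)) β := rfl
      rw [adjoint_rowOp_apply, rowOp_apply, hsum, hsub, normCoeff_single]
      simp only [mulTuple, adjoint_mulCoord, normCoeff_mulCoord_backShift]
      rw [← Finset.sum_smul, ← Finset.sum_div, hg, smul_smul]
      rcases eq_or_ne β 0 with rfl | hβ
      · simp
      · have h : 0 < ∑ i, β i := by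
          rw [Finset.sum_pos_iff]
          obtain ⟨i, hi⟩ := Function.ne_iff.mp hβ
          exact ⟨i, Finset.mem_univ i, Nat.pos_of_ne_zero hi⟩
        have h' : (1 : ℝ) ≤ ∑ i, (β i : ℝ) := by exact_mod_cast h
        have h2 : (m : ℝ) + ∑ i, (β i : ℝ) - 1 ≠ 0 := by
          have : (0 : ℝ) < m + ∑ i, (β i : ℝ) - 1 := by linarith
          exact this.ne'
        have h3 : ∑ i, (β i : ℝ) ≠ 0 := by linarith
        rw [if_neg hβ, sub_zero]
        simp only [c]
        push_cast
        rw [div_mul_div_cancel₀ h2, div_self h3, one_smul]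
    have hconst : (rowOp (mulTuple n m E)).adjoint (single m 0 (normCoeff f 0)) = 0 := by
      rw [adjoint_rowOp_apply]
      ext i : 1
      change (mulTuple n m E i).adjoint _ = 0
      simp only [mulTuple, adjoint_mulCoord]
      refine BergmanSpace.ext_coeff fun α => ?_
      rw [normCoeff_backShift, normCoeff_single, if_neg, smul_zero]
      · rfl
      · intro h
        simpa using congrFun h i
    change (rowOp (mulTuple n m E)).adjoint (rowOp (mulTuple n m E)
      ((rowOp (mulTuple n m E)).adjoint g)) = (rowOp (mulTuple n m E)).adjoint f
    rw [key, map_sub, hconst, sub_zero]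

variable (n m E) in
/-- The inverse `(M_z^* M_z)^{-1} : Im M_z^* → Im M_z^*`. -/
def gramInv : columnRange (mulTuple n m E) ≃ₗ[ℂ] columnRange (mulTuple n m E) :=
  (LinearEquiv.ofBijective (gram (mulTuple n m E)) gram_bijective).symm

end Gram

section Hypercontractions

variable {n : ℕ} {H : Type*} [NormedAddCommGroup H] [InnerProductSpace ℂ H] [CompleteSpace H]

/-- The map `σ_T(X) = ∑ T_i X T_i^*` on `L(H)`. -/
def sigma (T : Fin n → H →L[ℂ] H) : Module.End ℂ (H →L[ℂ] H) where
  toFun X := ∑ i, T i ∘L X ∘L (T i).adjoint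
  map_add' X Y := by simp [Finset.sum_add_distrib]
  map_smul' c X := by simp [Finset.smul_sum]

/-- The defect operator `Δ_T^{(k)} = (1 - σ_T)^k(1_H)`. -/
def defect (T : Fin n → H →L[ℂ] H) (k : ℕ) : H →L[ℂ] H :=
  ((1 - sigma T) ^ k) (ContinuousLinearMap.id ℂ H)

/-- `T` is an `m`-hypercontraction: a commuting tuple with `Δ_T^{(1)} ≥ 0` and
`Δ_T^{(m)} ≥ 0`. -/
structure IsHypercontraction (m : ℕ) (T : Fin n → H →L[ℂ] H) : Prop where
  commute : ∀ i k, Commute (T i) (T k)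
  defect_one : (defect T 1).IsPositive
  defect_m : (defect T m).IsPositive

/-- `T` is pure (of class `C_{·0}`): `σ_T^k(1_H) → 0` in the strong operator topology. -/
def IsPure (T : Fin n → H →L[ℂ] H) : Prop :=
  ∀ x, Filter.Tendsto (fun k : ℕ => (sigma T ^ k) (ContinuousLinearMap.id ℂ H) x)
    Filter.atTop (𝓝 0)

/-- `C = (Δ_T^{(m)})^{1/2}`, the positive square root. -/
def defectRoot (m : ℕ) (T : Fin n → H →L[ℂ] H) : H →L[ℂ] H :=
  CFC.sqrt (defect T m)

/-- The defect space `𝒟`, the closure of `C H`. -/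
def defectSpace (m : ℕ) (T : Fin n → H →L[ℂ] H) : Submodule ℂ H :=
  (LinearMap.range (defectRoot m T).toLinearMap).topologicalClosure

instance (m : ℕ) (T : Fin n → H →L[ℂ] H) : CompleteSpace (defectSpace m T) :=
  inferInstanceAs (CompleteSpace
    (LinearMap.range (defectRoot m T).toLinearMap).topologicalClosure)

/-- `C`, regarded as an operator `H → 𝒟`. -/
def defectRootTo (m : ℕ) (T : Fin n → H →L[ℂ] H) : H →L[ℂ] defectSpace m T :=
  (defectRoot m T).codRestrict (defectSpace m T) fun x =>
    Submodule.le_topologicalClosure _ ⟨x, rfl⟩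

/-- The product `T^α = T_1^{α_1} ⋯ T_n^{α_n}`. -/
def tuplePow (T : Fin n → H →L[ℂ] H) (α : Fin n → ℕ) : H →L[ℂ] H :=
  (List.ofFn fun i => T i ^ α i).prod

/-- The adjoint tuple `T^* = (T_1^*, …, T_n^*)`. -/
def adjointTuple (T : Fin n → H →L[ℂ] H) : Fin n → H →L[ℂ] H := fun i => (T i).adjoint

/-- The operator `∑_{j<m} (-1)^j binom(m, j+1) ∑_{|α|=j} γ_α T^α T^{*α}`, where
`γ_α = |α|! / α!`. -/
def weightedSum (m : ℕ) (T : Fin n → H →L[ℂ] H) : H →L[ℂ] H :=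
  ∑ j ∈ Finset.range m, ((-1) ^ j * (m.choose (j + 1)) : ℂ) •
    ∑ α ∈ Finset.piAntidiag (Finset.univ : Finset (Fin n)) j,
      (Nat.multinomial Finset.univ α : ℂ) • (tuplePow T α ∘L tuplePow (adjointTuple T) α)

/-- `j` is the map `j(x)(z) = ∑_α ρ_m(α) (C T^{*α} x) z^α`. -/
def IsCanonicalDilation (m : ℕ) [NeZero m] (T : Fin n → H →L[ℂ] H)
    (j : H → BergmanSpace n m (defectSpace m T)) : Prop :=
  ∀ (x : H) (z : Ball n), HasSum
    (fun α => monomial z.1 α • (rho m α : ℂ) • defectRootTo m T (tuplePow (adjointTuple T) α x))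
    (j x z)

/-- The data `f₀ ∈ 𝒟`, `x_1, …, x_n ∈ H` represent `f`: the tuple `(j x_i)` lies in `Im M_z^*`,
`f = f₀ + M_z (M_z^* M_z)^{-1} (j x_i)`, and
`C f₀ + T (∑_{j<m} (-1)^j binom(m, j+1) ∑_{|α|=j} γ_α T^α T^{*α} x_i)_i = 0`. -/
def IsRepresentation {m : ℕ} [NeZero m] (T : Fin n → H →L[ℂ] H)
    (j : H → BergmanSpace n m (defectSpace m T)) (f : BergmanSpace n m (defectSpace m T))
    (f₀ : defectSpace m T) (x : Fin n → H) : Prop :=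
  (∃ hx : WithLp.toLp 2 (fun i => j (x i)) ∈ columnRange (mulTuple n m (defectSpace m T)),
    f = constFun m f₀ + rowOp (mulTuple n m (defectSpace m T))
      (gramInv n m (defectSpace m T) ⟨_, hx⟩ : columnRange (mulTuple n m (defectSpace m T)))) ∧
  defectRoot m T f₀ + ∑ i, T i (weightedSum m T (x i)) = 0

end Hypercontractions

end

end BergmanBall

open BergmanBall

/-- The backward difference of a real sequence, `a k - a (k + 1)`. -/
def seqDiff (a : ℕ → ℝ) : ℕ → ℝ := fun k => a k - a (k + 1)

theorem tendsto_seqDiff_iterate {a : ℕ → ℝ} (ha : Filter.Tendsto a Filter.atTop (nhds 0)) (m : ℕ) :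
    Filter.Tendsto (seqDiff^[m] a) Filter.atTop (nhds 0) := by
  induction m with
  | zero => exact ha
  | succ m ih =>
    rw [Function.iterate_succ_apply']
    have h := ih.sub (ih.comp (Filter.tendsto_add_atTop_nat 1))
    rwa [sub_zero] at h

theorem hasSum_seqDiff_add {a : ℕ → ℝ} (ha : Filter.Tendsto a Filter.atTop (nhds 0))
    (h : ∀ k, 0 ≤ seqDiff a k) (l : ℕ) : HasSum (fun i => seqDiff a (l + i)) (a l) := by
  rw [hasSum_iff_tendsto_nat_of_nonneg fun i => h (l + i)]
  have h1 : ∀ N, ∑ i ∈ Finset.range N, seqDiff a (l + i) = a l - a (l + N) := fun N => by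
    simpa [seqDiff, add_assoc] using Finset.sum_range_sub' (fun i => a (l + i)) N
  simp_rw [h1]
  simpa using (ha.comp ((Filter.tendsto_add_atTop_nat l).congr fun N => add_comm N l)).const_sub (a l)

/-- A null sequence whose differences of order `m + 1` are nonnegative is recovered from these
differences by a binomially weighted sum. -/
theorem hasSum_choose_mul_seqDiff (m : ℕ) {a : ℕ → ℝ}
    (ha : Filter.Tendsto a Filter.atTop (nhds 0)) (h : ∀ k, 0 ≤ seqDiff^[m + 1] a k) :
    HasSum (fun k => ((k + m).choose m : ℝ) * seqDiff^[m + 1] a k) (a 0) := by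
  induction m with
  | zero => simpa using hasSum_seqDiff_add ha h 0
  | succ m ih =>
    set c := seqDiff^[m + 1] a with hc
    have hb : seqDiff^[m + 1 + 1] a = seqDiff c := by rw [Function.iterate_succ_apply']
    rw [hb] at h ⊢
    have hs := hasSum_seqDiff_add (tendsto_seqDiff_iterate ha (m + 1)) h
    have hc0 : ∀ l, 0 ≤ c l := fun l => (hs l).nonneg fun i => h (l + i)
    have h1 := ih hc0
    let F : ℕ × ℕ → ℝ := fun p => ((p.1 + m).choose m : ℝ) * seqDiff c (p.1 + p.2)
    have hrow : ∀ k, HasSum (fun i => F (k, i)) (((k + m).choose m : ℝ) * c k) := fun k =>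
      (hs k).mul_left _
    have hF : Summable F := by
      refine (summable_prod_of_nonneg fun p => mul_nonneg (Nat.cast_nonneg _) (h _)).mpr
        ⟨fun k => (hrow k).summable, ?_⟩
      exact h1.summable.congr fun k => ((hrow k).tsum_eq).symm
    have hF' : HasSum F (a 0) := (hF.hasSum.prod_fiberwise hrow).unique h1 ▸ hF.hasSum
    refine ((Finset.HasAntidiagonal.sigmaAntidiagonalEquivProd (A := ℕ)).hasSum_iff.mpr hF').sigma fun s => ?_
    have h2 := (Finset.HasAntidiagonal.antidiagonal s).hasSum F
    convert! h2 using 1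
    rw [Finset.Nat.sum_antidiagonal_eq_sum_range_succ_mk, ← add_assoc, ← Nat.sum_range_add_choose]
    push_cast
    rw [Finset.sum_mul]
    refine Finset.sum_congr rfl fun i hi => ?_
    simp only [F]
    rw [Nat.add_sub_cancel' (Finset.mem_range_succ_iff.mp hi)]

theorem seqDiff_iterate_eq_sum (m : ℕ) (a : ℕ → ℝ) (k : ℕ) :
    seqDiff^[m] a k = ∑ i ∈ Finset.range (m + 1), (-1) ^ i * (m.choose i : ℝ) * a (k + i) := by
  have h : ∀ m a, seqDiff^[m] a = fun k => (-1) ^ m * (fwdDiff 1)^[m] a k := by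
    intro m
    induction m with
    | zero => simp
    | succ m ih =>
      intro a
      rw [Function.iterate_succ_apply', Function.iterate_succ_apply', ih]
      ext k
      simp only [seqDiff, fwdDiff]
      ring
  rw [h]
  beta_reduce
  rw [fwdDiff_iter_eq_sum_shift, Finset.mul_sum]
  refine Finset.sum_congr rfl fun i hi => ?_
  have hi := Finset.mem_range_succ_iff.mp hi
  obtain ⟨d, rfl⟩ := Nat.exists_eq_add_of_le hi
  have : ((-1 : ℝ) ^ d) * (-1) ^ d = 1 := by rw [← mul_pow]; simp
  simp only [Nat.add_sub_cancel_left, zsmul_eq_mul, smul_eq_mul, mul_one]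
  push_cast
  linear_combination (-1) ^ i * ((i + d).choose i : ℝ) * a (k + i) * this

theorem hasSum_choose_succ_mul_seqDiff (m : ℕ) {a : ℕ → ℝ}
    (ha : Filter.Tendsto a Filter.atTop (nhds 0)) (h : ∀ k, 0 ≤ seqDiff^[m + 1] a k) :
    HasSum (fun k => ((k + m + 1).choose m : ℝ) * seqDiff^[m + 1] a k)
      (∑ i ∈ Finset.range (m + 1), (-1) ^ i * ((m + 1).choose (i + 1) : ℝ) * a i) := by
  set t := ∑ i ∈ Finset.range (m + 1), (-1) ^ i * ((m + 1).choose (i + 1) : ℝ) * a i with ht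
  let a' : ℕ → ℝ := fun k => Nat.casesOn k t a
  have hsucc : ∀ k, seqDiff^[m + 1] a' (k + 1) = seqDiff^[m + 1] a k := fun k => by
    rw [seqDiff_iterate_eq_sum, seqDiff_iterate_eq_sum]
    exact Finset.sum_congr rfl fun i _ => by rw [Nat.succ_add]
  have hzero : seqDiff^[m + 1] a' 0 = 0 := by
    rw [seqDiff_iterate_eq_sum, Finset.sum_range_succ']
    simp only [zero_add, pow_zero, Nat.choose_zero_right, Nat.cast_one, one_mul]
    change _ + t = 0
    rw [ht, ← Finset.sum_add_distrib]
    refine Finset.sum_eq_zero fun i _ => ?_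
    change (-1) ^ (i + 1) * ((m + 1).choose (i + 1) : ℝ) * a i + _ = 0
    ring
  have h1 := hasSum_choose_mul_seqDiff m (a := a')
    ((Filter.tendsto_add_atTop_iff_nat 1).mp ha)
    (fun k => by cases k with
      | zero => exact hzero.ge
      | succ k => rw [hsucc]; exact h k)
  rw [← hasSum_nat_add_iff' 1] at h1
  simp only [Finset.sum_range_one, hzero, mul_zero, sub_zero, hsucc] at h1
  convert! h1 using 5 with k
  ring

open scoped InnerProductSpace

section TuplePowers

theorem pairwise_commute_pow {R ι : Type*} [Monoid R] {T : ι → R}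
    (hT : ∀ i k, Commute (T i) (T k)) (α : ι → ℕ) (s : Set ι) :
    s.Pairwise (Function.onFun Commute fun i => T i ^ α i) :=
  fun i _ k _ _ => (hT i k).pow_pow _ _

variable {n : ℕ} {H : Type*} [NormedAddCommGroup H] [InnerProductSpace ℂ H]

theorem tuplePow_eq_noncommProd {T : Fin n → H →L[ℂ] H} (hT : ∀ i k, Commute (T i) (T k))
    (α : Fin n → ℕ) :
    tuplePow T α = Finset.univ.noncommProd (fun i => T i ^ α i)
      (pairwise_commute_pow hT α _) := by
  rw [tuplePow, List.ofFn_eq_map,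
    ← Finset.noncommProd_toFinset _ _ (pairwise_commute_pow hT α _)
      (List.nodup_finRange n)]
  exact Finset.noncommProd_congr (by ext; simp) (fun _ _ => rfl) _

theorem tuplePow_add_single {T : Fin n → H →L[ℂ] H} (hT : ∀ i k, Commute (T i) (T k))
    (α : Fin n → ℕ) (i : Fin n) : tuplePow T (α + Pi.single i 1) = tuplePow T α * T i := by
  rw [tuplePow_eq_noncommProd hT, tuplePow_eq_noncommProd hT,
    ← Finset.noncommProd_erase_mul Finset.univ (Finset.mem_univ i) _ _ (pairwise_commute_pow hT _ _),
    ← Finset.noncommProd_erase_mul Finset.univ (Finset.mem_univ i) (fun i => T i ^ α i) _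
      (pairwise_commute_pow hT _ _),
    Pi.add_apply, Pi.single_eq_same, pow_succ, ← mul_assoc]
  congr 2
  refine Finset.noncommProd_congr rfl (fun k hk => ?_) _
  simp [Finset.ne_of_mem_erase hk]

variable [CompleteSpace H]

theorem adjointTuple_commute {T : Fin n → H →L[ℂ] H} (hT : ∀ i k, Commute (T i) (T k))
    (i k : Fin n) : Commute (adjointTuple T i) (adjointTuple T k) :=
  (hT i k).star_star

theorem adjoint_tuplePow {T : Fin n → H →L[ℂ] H} (hT : ∀ i k, Commute (T i) (T k))
    (α : Fin n → ℕ) : (tuplePow T α).adjoint = tuplePow (adjointTuple T) α := by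
  have hstar : ∀ l : List (H →L[ℂ] H), star l.prod = (l.map star).reverse.prod := by
    intro l
    induction l with
    | nil => simp
    | cons a l ih => simp [ih]
  have hc : (List.ofFn fun i => adjointTuple T i ^ α i).Pairwise Commute :=
    List.pairwise_ofFn.mpr fun i k _ => (adjointTuple_commute hT i k).pow_pow _ _
  change star (tuplePow T α) = _
  rw [tuplePow, tuplePow, hstar, List.map_ofFn, (List.reverse_perm _).symm.prod_eq' hc]
  congr 3
  exact funext fun i => star_pow _ _

/-- The map `A ↦ (X ↦ A X A^*)`. -/
noncomputable def conjugation : (H →L[ℂ] H) →* Module.End ℂ (H →L[ℂ] H) where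
  toFun A := LinearMap.mulLeft ℂ A * LinearMap.mulRight ℂ (star A)
  map_one' := by ext; simp
  map_mul' A B := by
    refine LinearMap.ext fun X => ?_
    simp [mul_assoc]

theorem conjugation_apply (A X : H →L[ℂ] H) : conjugation A X = A * (X * star A) := rfl

theorem sigma_pow_apply {T : Fin n → H →L[ℂ] H} (hT : ∀ i k, Commute (T i) (T k)) (k : ℕ)
    (X : H →L[ℂ] H) :
    (sigma T ^ k) X = ∑ α ∈ Finset.piAntidiag (Finset.univ : Finset (Fin n)) k,
      (Nat.multinomial Finset.univ α : ℂ) •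
        (tuplePow T α ∘L X ∘L tuplePow (adjointTuple T) α) := by
  have h : sigma T = ∑ i, conjugation (T i) := by
    ext1 X
    rw [LinearMap.sum_apply]
    rfl
  have hc : ∀ s : Set (Fin n), s.Pairwise (Function.onFun Commute fun i => conjugation (T i)) :=
    fun s i _ k _ _ => (hT i k).map conjugation
  rw [h, Finset.sum_pow_eq_sum_piAntidiag_of_commute _ _ (hc _), LinearMap.sum_apply]
  refine Finset.sum_congr rfl fun α _ => ?_
  have h1 : Finset.univ.noncommProd (fun i => conjugation (T i) ^ α i)
      (pairwise_commute_pow (fun i k => (hT i k).map conjugation) α _) = conjugation (tuplePow T α) := by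
    rw [tuplePow_eq_noncommProd hT, Finset.map_noncommProd]
    simp only [map_pow]
  rw [h1, ← nsmul_eq_mul, LinearMap.smul_apply, conjugation_apply, Nat.cast_smul_eq_nsmul,
    ← adjoint_tuplePow hT]
  rfl

theorem weightedSum_eq {T : Fin n → H →L[ℂ] H} (hT : ∀ i k, Commute (T i) (T k)) (m : ℕ) :
    weightedSum m T = ∑ j ∈ Finset.range m, ((-1) ^ j * (m.choose (j + 1)) : ℂ) •
      (sigma T ^ j) (ContinuousLinearMap.id ℂ H) := by
  simp only [weightedSum, sigma_pow_apply hT]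
  rfl

/-- The scalar orbit `k ↦ ⟨σ_T^k(X) x, x⟩` of an operator `X`. -/
noncomputable def sigmaOrbit (T : Fin n → H →L[ℂ] H) (X : H →L[ℂ] H) (x : H) (k : ℕ) : ℝ :=
  (⟪(sigma T ^ k) X x, x⟫_ℂ).re

theorem seqDiff_iterate_sigmaOrbit (T : Fin n → H →L[ℂ] H) (m : ℕ) (X : H →L[ℂ] H) (x : H) :
    seqDiff^[m] (sigmaOrbit T X x) = sigmaOrbit T (((1 - sigma T) ^ m) X) x := by
  induction m generalizing X with
  | zero => rfl
  | succ m ih =>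
    have h : seqDiff (sigmaOrbit T X x) = sigmaOrbit T ((1 - sigma T) X) x := by
      ext k
      simp only [seqDiff, sigmaOrbit, pow_succ, LinearMap.sub_apply, map_sub, Module.End.mul_apply,
        Module.End.one_apply, sub_apply, inner_sub_left, Complex.sub_re]
    rw [Function.iterate_succ_apply, h, ih, pow_succ]
    rfl

theorem tendsto_sigmaOrbit {T : Fin n → H →L[ℂ] H} (hpure : IsPure T) (x : H) :
    Filter.Tendsto (sigmaOrbit T (ContinuousLinearMap.id ℂ H) x) Filter.atTop (nhds 0) := by
  have h := Complex.continuous_re.continuousAt.tendsto.comp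
    ((hpure x).inner (𝕜 := ℂ) (tendsto_const_nhds (x := x)))
  rw [inner_zero_left] at h
  exact h

end TuplePowers

section Defect

variable {n m : ℕ} {H : Type*} [NormedAddCommGroup H] [InnerProductSpace ℂ H] [CompleteSpace H]
  {T : Fin n → H →L[ℂ] H}

theorem isSelfAdjoint_defectRoot (m : ℕ) (T : Fin n → H →L[ℂ] H) :
    IsSelfAdjoint (defectRoot m T) :=
  IsSelfAdjoint.of_nonneg (CFC.sqrt_nonneg _)

theorem defectRoot_mul_self (hT : IsHypercontraction m T) :
    defectRoot m T * defectRoot m T = defect T m :=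
  CFC.sqrt_mul_sqrt_self _ ((ContinuousLinearMap.nonneg_iff_isPositive _).mpr hT.defect_m)

theorem inner_tuplePow_defect (hT : IsHypercontraction m T) (α : Fin n → ℕ) (x : H) :
    ⟪(tuplePow T α ∘L defect T m ∘L tuplePow (adjointTuple T) α) x, x⟫_ℂ
      = ((‖defectRoot m T (tuplePow (adjointTuple T) α x)‖ ^ 2 : ℝ) : ℂ) := by
  have hsa : (defectRoot m T).adjoint = defectRoot m T := isSelfAdjoint_defectRoot m T
  rw [← defectRoot_mul_self hT, ContinuousLinearMap.comp_apply,
    ← ContinuousLinearMap.adjoint_inner_right, adjoint_tuplePow hT.commute,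
    ContinuousLinearMap.comp_apply, ContinuousLinearMap.mul_def,
    ContinuousLinearMap.comp_apply, ← ContinuousLinearMap.adjoint_inner_right, hsa, inner_self_eq_norm_sq_to_K]
  simp

theorem sigmaOrbit_defect (hT : IsHypercontraction m T) (x : H) (k : ℕ) :
    sigmaOrbit T (defect T m) x k = ∑ α ∈ Finset.piAntidiag (Finset.univ : Finset (Fin n)) k,
      (Nat.multinomial Finset.univ α : ℝ)
        * ‖defectRoot m T (tuplePow (adjointTuple T) α x)‖ ^ 2 := by
  rw [sigmaOrbit, sigma_pow_apply hT.commute, sum_apply, sum_inner,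
    Complex.re_sum]
  refine Finset.sum_congr rfl fun α _ => ?_
  rw [smul_apply, inner_smul_left, inner_tuplePow_defect hT, map_natCast,
    ← Complex.ofReal_natCast, ← Complex.ofReal_mul, Complex.ofReal_re]

theorem sigmaOrbit_defect_nonneg (hT : IsHypercontraction m T) (x : H) (k : ℕ) :
    0 ≤ sigmaOrbit T (defect T m) x k := by
  rw [sigmaOrbit_defect hT]
  positivity

theorem hasSum_multiindex (hT : IsHypercontraction m T) (x : H) {w : ℕ → ℝ} (hw : ∀ k, 0 ≤ w k)
    {s : ℝ} (h : HasSum (fun k => w k * sigmaOrbit T (defect T m) x k) s) :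
    HasSum (fun α : Fin n → ℕ => w (∑ i, α i) * Nat.multinomial Finset.univ α
      * ‖defectRoot m T (tuplePow (adjointTuple T) α x)‖ ^ 2) s := by
  set F : (Fin n → ℕ) → ℝ := fun α => w (∑ i, α i) * Nat.multinomial Finset.univ α
      * ‖defectRoot m T (tuplePow (adjointTuple T) α x)‖ ^ 2 with hF
  have hF0 : ∀ α, 0 ≤ F α := fun α => by have := hw (∑ i, α i); positivity
  have key : ∀ k, HasSum (fun α : {α : Fin n → ℕ // ∑ i, α i = k} => F α.1)
      (w k * sigmaOrbit T (defect T m) x k) := by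
    intro k
    rw [← (degreeEquiv n k).symm.hasSum_iff, sigmaOrbit_defect hT, Finset.mul_sum]
    convert! Finset.hasSum (Finset.piAntidiag (Finset.univ : Finset (Fin n)) k)
      (fun α => w k * ((Nat.multinomial Finset.univ α : ℝ)
        * ‖defectRoot m T (tuplePow (adjointTuple T) α x)‖ ^ 2)) using 1
    ext α
    have hα : ∑ i, α.1 i = k := ((degreeEquiv n k).symm α).2
    simp only [Function.comp_apply, degreeEquiv, Equiv.subtypeEquivRight_symm_apply_coe, hF, hα]
    ring
  have hs : Summable F := by
    rw [← (Equiv.sigmaFiberEquiv fun α : Fin n → ℕ => ∑ i, α i).summable_iff]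
    exact (summable_sigma_of_nonneg fun _ => hF0 _).mpr
      ⟨fun k => (key k).summable, h.summable.congr fun k => (key k).tsum_eq.symm⟩
  exact (((Equiv.sigmaFiberEquiv fun α : Fin n → ℕ => ∑ i, α i).hasSum_iff.mpr
    hs.hasSum).sigma key).unique h ▸ hs.hasSum

theorem hasSum_rho_defectRoot [NeZero m] (hT : IsHypercontraction m T) (hpure : IsPure T) (x : H) :
    HasSum (fun α : Fin n → ℕ => rho m α
      * ‖defectRoot m T (tuplePow (adjointTuple T) α x)‖ ^ 2) (‖x‖ ^ 2) := by
  obtain ⟨k, rfl⟩ := Nat.exists_eq_succ_of_ne_zero (NeZero.ne m)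
  have h := hasSum_choose_mul_seqDiff k (tendsto_sigmaOrbit hpure x)
  rw [seqDiff_iterate_sigmaOrbit] at h
  have h1 := hasSum_multiindex hT x (w := fun l => ((l + k).choose k : ℝ))
    (fun _ => Nat.cast_nonneg _) (h (sigmaOrbit_defect_nonneg hT x))
  have h2 : sigmaOrbit T (ContinuousLinearMap.id ℂ H) x 0 = ‖x‖ ^ 2 := by
    simp [sigmaOrbit, ← Complex.ofReal_pow]
  rw [← h2]
  simpa only [rho_eq, Nat.succ_sub_one, Nat.succ_eq_add_one] using h1

theorem re_inner_weightedSum (hT : ∀ i k, Commute (T i) (T k)) (m : ℕ) (x : H) :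
    (⟪weightedSum m T x, x⟫_ℂ).re = ∑ i ∈ Finset.range m, (-1) ^ i * (m.choose (i + 1) : ℝ)
      * sigmaOrbit T (ContinuousLinearMap.id ℂ H) x i := by
  rw [weightedSum_eq hT, sum_apply, sum_inner, Complex.re_sum]
  refine Finset.sum_congr rfl fun j _ => ?_
  have : ((-1) ^ j * (m.choose (j + 1)) : ℂ) = (((-1) ^ j * (m.choose (j + 1)) : ℝ) : ℂ) := by
    push_cast; rfl
  rw [smul_apply, inner_smul_left, this, Complex.conj_ofReal,
    Complex.re_ofReal_mul, sigmaOrbit]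

theorem hasSum_weighted_rho_defectRoot [NeZero m] (hT : IsHypercontraction m T) (hpure : IsPure T)
    (x : H) :
    HasSum (fun α : Fin n → ℕ => (m + ∑ i, α i : ℝ) / (∑ i, α i + 1) * (rho m α
      * ‖defectRoot m T (tuplePow (adjointTuple T) α x)‖ ^ 2)) (⟪weightedSum m T x, x⟫_ℂ).re := by
  rw [re_inner_weightedSum hT.commute]
  obtain ⟨k, rfl⟩ := Nat.exists_eq_succ_of_ne_zero (NeZero.ne m)
  have h := hasSum_choose_succ_mul_seqDiff k (tendsto_sigmaOrbit hpure x)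
  rw [seqDiff_iterate_sigmaOrbit] at h
  have h1 := hasSum_multiindex hT x (w := fun l => ((l + k + 1).choose k : ℝ))
    (fun _ => Nat.cast_nonneg _) (h (sigmaOrbit_defect_nonneg hT x))
  convert! h1 using 2 with α
  rw [rho_eq, Nat.succ_sub_one, ← mul_assoc, ← mul_assoc]
  congr 2
  have h3 := Nat.choose_mul_succ_eq (∑ i, α i + k) k
  rw [show ∑ i, α i + k + 1 - k = ∑ i, α i + 1 by omega] at h3
  rw [div_mul_eq_mul_div, div_eq_iff (by positivity)]
  have h4 : (((∑ i, α i + k).choose k * (∑ i, α i + k + 1) : ℕ) : ℝ)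
      = ((∑ i, α i + k + 1).choose k * (∑ i, α i + 1) : ℕ) := by rw [h3]
  push_cast at h4 ⊢
  linarith

end Defect

section Space

variable {n m : ℕ} {E : Type*} [NormedAddCommGroup E] [InnerProductSpace ℂ E]

/-- The operator multiplying the Taylor coefficients with a bounded family of real scalars. -/
noncomputable def diagonal (c : (Fin n → ℕ) → ℝ) (C : ℝ) (hc : ∀ α, |c α| ≤ C) :
    BergmanSpace n m E →L[ℂ] BergmanSpace n m E :=
  have le (f : BergmanSpace n m E) (α : Fin n → ℕ) :
      ‖c α • normCoeff f α‖ ≤ ‖((C : ℂ) • normCoeff f) α‖ := by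
    rw [lp.coeFn_smul, Pi.smul_apply, norm_smul, norm_smul, Complex.norm_real]
    exact mul_le_mul_of_nonneg_right ((hc α).trans (le_abs_self C)) (norm_nonneg _)
  have sm (f : BergmanSpace n m E) : Summable fun α =>
      ‖((C : ℂ) • normCoeff f) α‖ ^ (2 : ENNReal).toReal :=
    (lp.memℓp ((C : ℂ) • normCoeff f)).summable (by norm_num)
  have le' (f : BergmanSpace n m E) (α : Fin n → ℕ) :=
    Real.rpow_le_rpow (z := (2 : ENNReal).toReal) (norm_nonneg _) (le f α) (by norm_num)
  have sm' (f : BergmanSpace n m E) := Summable.of_nonneg_of_le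
    (fun _ => Real.rpow_nonneg (norm_nonneg _) _) (le' f) (sm f)
  LinearMap.mkContinuous
    { toFun := fun f =>
        (⟨fun α => c α • normCoeff f α, memℓp_gen (sm' f)⟩ : lp (fun _ : Fin n → ℕ => E) 2)
      map_add' := fun f g => lp.ext (funext fun α => smul_add _ _ _)
      map_smul' := fun c f => lp.ext (funext fun α => smul_comm _ _ _) }
    |C| fun f => by
      rw [← Real.norm_eq_abs, ← Complex.norm_real, ← norm_smul]
      refine lp.norm_le_of_tsum_le (by norm_num) (norm_nonneg _) ?_
      refine ((sm' f).tsum_le_tsum (le' f) (sm f)).trans ?_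
      exact (lp.norm_rpow_eq_tsum (by norm_num) ((C : ℂ) • normCoeff f)).ge

theorem normCoeff_diagonal (c : (Fin n → ℕ) → ℝ) (C : ℝ) (hc : ∀ α, |c α| ≤ C)
    (f : BergmanSpace n m E) (α : Fin n → ℕ) :
    normCoeff (diagonal c C hc f) α = c α • normCoeff f α := rfl

theorem normCoeff_sub (f g : BergmanSpace n m E) (α : Fin n → ℕ) :
    normCoeff (f - g) α = normCoeff f α - normCoeff g α := rfl

theorem normCoeff_sum {ι : Type*} (s : Finset ι) (F : ι → BergmanSpace n m E) (α : Fin n → ℕ) :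
    normCoeff (∑ i ∈ s, F i) α = ∑ i ∈ s, normCoeff (F i) α := by
  induction s using Finset.cons_induction with
  | empty => rfl
  | cons a s ha ih => rw [Finset.sum_cons, Finset.sum_cons, normCoeff_add, ih]

theorem abs_div_sum_le (m : ℕ) [NeZero m] (α : Fin n → ℕ) :
    |((m : ℝ) + (∑ i, α i : ℕ) - 1) / (∑ i, α i : ℕ)| ≤ m := by
  have hm : (1 : ℝ) ≤ m := by exact_mod_cast NeZero.one_le (n := m)
  rcases Nat.eq_zero_or_pos (∑ i, α i) with h | h
  · rw [h]
    simp
  · have h' : (1 : ℝ) ≤ (∑ i, α i : ℕ) := by exact_mod_cast h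
    rw [abs_of_nonneg (div_nonneg (by linarith) (by linarith)), div_le_iff₀ (by linarith)]
    nlinarith

theorem abs_div_sum_add_one_le (m : ℕ) [NeZero m] (α : Fin n → ℕ) :
    |((m : ℝ) + (∑ i, α i : ℕ)) / ((∑ i, α i : ℕ) + 1)| ≤ m := by
  have hm : (1 : ℝ) ≤ m := by exact_mod_cast NeZero.one_le (n := m)
  have h : (0 : ℝ) ≤ (∑ i, α i : ℕ) := Nat.cast_nonneg _
  rw [abs_of_nonneg (by positivity), div_le_iff₀ (by linarith)]
  nlinarith

variable (n m E) in
/-- The diagonal operator on `H_m(𝔹, E)` inverting `M_z M_z^*` on functions vanishing at `0`. -/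
noncomputable def gramDiagonal [NeZero m] : BergmanSpace n m E →L[ℂ] BergmanSpace n m E :=
  diagonal _ m (abs_div_sum_le m)

variable (n m E) in
/-- The diagonal operator with `M_{z_i}^* gramDiagonal = gramDiagonalShift M_{z_i}^*`. -/
noncomputable def gramDiagonalShift [NeZero m] : BergmanSpace n m E →L[ℂ] BergmanSpace n m E :=
  diagonal _ m (abs_div_sum_add_one_le m)

theorem backShift_gramDiagonal [NeZero m] (i : Fin n) (f : BergmanSpace n m E) :
    backShift i (gramDiagonal n m E f) = gramDiagonalShift n m E (backShift i f) := by
  refine BergmanSpace.ext_coeff fun α => ?_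
  rw [normCoeff_backShift, gramDiagonal, gramDiagonalShift, normCoeff_diagonal, normCoeff_diagonal,
    normCoeff_backShift, smul_comm]
  have h : ((∑ k, (α + Pi.single i 1 : Fin n → ℕ) k : ℕ) : ℝ) = (∑ k, α k : ℕ) + 1 := by
    simp [Finset.sum_add_distrib]
  rw [h, ← add_assoc, add_sub_cancel_right]

theorem backShift_constFun [NeZero m] (i : Fin n) (v : E) :
    backShift i (constFun m v : BergmanSpace n m E) = 0 := by
  refine BergmanSpace.ext_coeff fun α => ?_
  rw [normCoeff_backShift, constFun, normCoeff_single, if_neg, smul_zero]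
  · rfl
  · intro h
    simpa using congrFun h i

variable [CompleteSpace E] [NeZero m]

theorem adjoint_rowOp_mulTuple (f : BergmanSpace n m E) :
    (rowOp (mulTuple n m E)).adjoint f = WithLp.toLp 2 fun i => backShift i f := by
  rw [adjoint_rowOp_apply]
  simp only [mulTuple, adjoint_mulCoord]

theorem adjoint_rowOp_constFun (v : E) :
    (rowOp (mulTuple n m E)).adjoint (constFun m v) = 0 := by
  rw [adjoint_rowOp_mulTuple]
  simp only [backShift_constFun]
  rfl

theorem rowOp_adjoint_gramDiagonal (f : BergmanSpace n m E) :
    rowOp (mulTuple n m E) ((rowOp (mulTuple n m E)).adjoint (gramDiagonal n m E f))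
      = f - constFun m (normCoeff f 0) := by
  refine BergmanSpace.ext_coeff fun β => ?_
  rw [adjoint_rowOp_mulTuple, rowOp_apply, normCoeff_sum, normCoeff_sub, constFun,
    normCoeff_single]
  simp only [mulTuple, normCoeff_mulCoord_backShift]
  rw [← Finset.sum_smul, ← Finset.sum_div, gramDiagonal, normCoeff_diagonal, smul_smul]
  rcases eq_or_ne β 0 with rfl | hβ
  · simp
  · have h : 0 < ∑ i, β i := by
      rw [Finset.sum_pos_iff]
      obtain ⟨i, hi⟩ := Function.ne_iff.mp hβ
      exact ⟨i, Finset.mem_univ i, Nat.pos_of_ne_zero hi⟩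
    have hm : (1 : ℝ) ≤ m := by exact_mod_cast NeZero.one_le (n := m)
    have h' : (1 : ℝ) ≤ ∑ i, (β i : ℝ) := by exact_mod_cast h
    have h2 : (m : ℝ) + ∑ i, (β i : ℝ) - 1 ≠ 0 := by
      have : (0 : ℝ) < m + ∑ i, (β i : ℝ) - 1 := by linarith
      exact this.ne'
    have h3 : ∑ i, (β i : ℝ) ≠ 0 := by linarith
    rw [if_neg hβ, sub_zero]
    push_cast
    rw [div_mul_div_cancel₀ h2, div_self h3, one_smul]

theorem coe_gramInv (f : BergmanSpace n m E)
    (h : (rowOp (mulTuple n m E)).adjoint f ∈ columnRange (mulTuple n m E)) :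
    (gramInv n m E ⟨_, h⟩ : PiLp 2 fun _ : Fin n => BergmanSpace n m E)
      = (rowOp (mulTuple n m E)).adjoint (gramDiagonal n m E f) := by
  have : gramInv n m E ⟨_, h⟩
      = ⟨(rowOp (mulTuple n m E)).adjoint (gramDiagonal n m E f), _, rfl⟩ := by
    rw [gramInv, LinearEquiv.symm_apply_eq]
    refine Subtype.ext ?_
    change _ = (rowOp (mulTuple n m E)).adjoint (rowOp (mulTuple n m E)
      ((rowOp (mulTuple n m E)).adjoint (gramDiagonal n m E f)))
    rw [rowOp_adjoint_gramDiagonal, map_sub, adjoint_rowOp_constFun, sub_zero]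
  rw [this]

theorem constFun_add_rowOp_gramInv (f : BergmanSpace n m E)
    (h : (rowOp (mulTuple n m E)).adjoint f ∈ columnRange (mulTuple n m E)) :
    constFun m (normCoeff f 0) + rowOp (mulTuple n m E)
      (gramInv n m E ⟨_, h⟩ : columnRange (mulTuple n m E)) = f := by
  rw [coe_gramInv, rowOp_adjoint_gramDiagonal, add_sub_cancel]

theorem adjoint_rowOp_rowOp_gramInv (h : columnRange (mulTuple n m E)) :
    (rowOp (mulTuple n m E)).adjoint (rowOp (mulTuple n m E) (gramInv n m E h)) = h := by
  have := (gramInv n m E).symm_apply_apply h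
  exact congrArg Subtype.val this

end Space

section Dilation

variable {n m : ℕ} [NeZero m] {H : Type*} [NormedAddCommGroup H] [InnerProductSpace ℂ H]
  [CompleteSpace H] {T : Fin n → H →L[ℂ] H}

theorem hasSum_norm_sq_dilation (hT : IsHypercontraction m T) (hpure : IsPure T) (x : H) :
    HasSum (fun α : Fin n → ℕ =>
      ‖√(rho m α) • defectRootTo m T (tuplePow (adjointTuple T) α x)‖ ^ (2 : ENNReal).toReal)
      (‖x‖ ^ 2) := by
  convert! hasSum_rho_defectRoot hT hpure x using 2 with α
  rw [ENNReal.toReal_ofNat, Real.rpow_ofNat, norm_smul, mul_pow,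
    Real.norm_of_nonneg (Real.sqrt_nonneg _), Real.sq_sqrt (rho_pos m α).le]
  rfl

/-- The map `j(x)(z) = ∑ ρ_m(α) (C T^{*α} x) z^α`, as an isometry. -/
noncomputable def dilation (hT : IsHypercontraction m T) (hpure : IsPure T) :
    H →ₗᵢ[ℂ] BergmanSpace n m (defectSpace m T) where
  toFun x := (⟨fun α => √(rho m α) • defectRootTo m T (tuplePow (adjointTuple T) α x),
    memℓp_gen (hasSum_norm_sq_dilation hT hpure x).summable⟩ :
      lp (fun _ : Fin n → ℕ => defectSpace m T) 2)
  map_add' x y := lp.ext <| funext fun α => by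
    simp only [map_add, smul_add]
    rfl
  map_smul' c x := lp.ext <| funext fun α => by
    simp only [map_smul, smul_comm _ c]
    rfl
  norm_map' x := by
    have h (g : lp (fun _ : Fin n → ℕ => defectSpace m T) 2) :
        ‖g‖ ^ 2 = ∑' α, ‖g α‖ ^ (2 : ENNReal).toReal := by
      rw [← lp.norm_rpow_eq_tsum (by norm_num), ENNReal.toReal_ofNat, Real.rpow_ofNat]
    have h2 := (h ⟨_, memℓp_gen (hasSum_norm_sq_dilation hT hpure x).summable⟩).trans
      (hasSum_norm_sq_dilation hT hpure x).tsum_eq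
    exact (sq_eq_sq₀ (norm_nonneg _) (norm_nonneg _)).mp h2

variable (hT : IsHypercontraction m T) (hpure : IsPure T)

theorem normCoeff_dilation (x : H) (α : Fin n → ℕ) :
    normCoeff (dilation hT hpure x) α
      = √(rho m α) • defectRootTo m T (tuplePow (adjointTuple T) α x) := rfl

theorem isCanonicalDilation_dilation : IsCanonicalDilation m T (dilation hT hpure) := by
  intro x z
  convert! BergmanSpace.hasSum_apply (dilation hT hpure x) z using 3 with α
  rw [coeff, normCoeff_dilation, smul_smul, Real.mul_self_sqrt (rho_pos m α).le, Complex.coe_smul]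

theorem backShift_dilation (i : Fin n) (x : H) :
    backShift i (dilation hT hpure x) = dilation hT hpure ((T i).adjoint x) := by
  refine BergmanSpace.ext_coeff fun α => ?_
  rw [normCoeff_backShift, normCoeff_dilation, normCoeff_dilation, smul_smul,
    ← Real.sqrt_mul (div_nonneg (rho_pos m α).le (rho_pos m _).le),
    div_mul_cancel₀ _ (rho_pos m _).ne', tuplePow_add_single (adjointTuple_commute hT.commute)]
  rfl

theorem adjoint_dilation_mulCoord (i : Fin n) (g : BergmanSpace n m (defectSpace m T)) :
    (dilation hT hpure).toContinuousLinearMap.adjoint (mulCoord i g)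
      = T i ((dilation hT hpure).toContinuousLinearMap.adjoint g) := by
  refine ext_inner_left ℂ fun y => ?_
  rw [ContinuousLinearMap.adjoint_inner_right, ← ContinuousLinearMap.adjoint_inner_left (T i),
    ContinuousLinearMap.adjoint_inner_right, ← ContinuousLinearMap.adjoint_inner_left (mulCoord i),
    adjoint_mulCoord]
  exact congrArg (⟪·, g⟫_ℂ) (backShift_dilation hT hpure i y)

theorem adjoint_dilation_constFun (v : defectSpace m T) :
    (dilation hT hpure).toContinuousLinearMap.adjoint (constFun m v) = defectRoot m T v := by
  refine ext_inner_right ℂ fun y => ?_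
  have h1 : tuplePow (adjointTuple T) 0 = 1 := by simp [tuplePow]
  rw [ContinuousLinearMap.adjoint_inner_left, constFun, inner_single,
    LinearIsometry.coe_toContinuousLinearMap, normCoeff_dilation, rho_zero, Real.sqrt_one, one_smul,
    h1, ← ContinuousLinearMap.adjoint_inner_right,
    show (defectRoot m T).adjoint = defectRoot m T from isSelfAdjoint_defectRoot m T]
  rfl

theorem isSelfAdjoint_weightedSum {T : Fin n → H →L[ℂ] H} (hT : ∀ i k, Commute (T i) (T k))
    (m : ℕ) : IsSelfAdjoint (weightedSum m T) := by
  change star _ = _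
  rw [weightedSum, star_sum]
  refine Finset.sum_congr rfl fun j _ => ?_
  rw [star_smul, star_sum]
  congr 1
  · simp
  · refine Finset.sum_congr rfl fun α _ => ?_
    rw [star_smul, star_natCast]
    congr 1
    change (_ ∘L _).adjoint = _
    rw [ContinuousLinearMap.adjoint_comp, ← adjoint_tuplePow hT,
      ContinuousLinearMap.adjoint_adjoint]

theorem adjoint_dilation_gramDiagonalShift (x : H) :
    (dilation hT hpure).toContinuousLinearMap.adjoint
      (gramDiagonalShift n m (defectSpace m T) (dilation hT hpure x)) = weightedSum m T x := by
  set J := (dilation hT hpure).toContinuousLinearMap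
  have h : (J.adjoint ∘L gramDiagonalShift n m (defectSpace m T) ∘L J).toLinearMap
      = (weightedSum m T).toLinearMap := by
    refine (ext_inner_map _ _).mp fun x => ?_
    change ⟪J.adjoint (gramDiagonalShift n m (defectSpace m T) (dilation hT hpure x)), x⟫_ℂ
      = ⟪weightedSum m T x, x⟫_ℂ
    rw [ContinuousLinearMap.adjoint_inner_left]
    have h1 := Complex.hasSum_ofReal.mpr (hasSum_weighted_rho_defectRoot hT hpure x)
    have h2 : ((⟪weightedSum m T x, x⟫_ℂ).re : ℂ) = ⟪weightedSum m T x, x⟫_ℂ :=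
      (isSelfAdjoint_weightedSum hT.commute m).isSymmetric.coe_re_inner_apply_self x
    rw [h2] at h1
    refine HasSum.unique ?_ h1
    convert! inner_eq (gramDiagonalShift n m (defectSpace m T) (dilation hT hpure x))
      (dilation hT hpure x) using 2 with α
    rw [gramDiagonalShift, normCoeff_diagonal, normCoeff_dilation, ← Complex.coe_smul,
      ← Complex.coe_smul, inner_smul_left, inner_smul_left, inner_smul_right, Complex.conj_ofReal,
      Complex.conj_ofReal, inner_self_eq_norm_sq_to_K, ← mul_assoc (√(rho m α) : ℂ),
      ← Complex.ofReal_mul (√(rho m α)), Real.mul_self_sqrt (rho_pos m α).le]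
    push_cast
    rfl
  exact LinearMap.congr_fun h x

theorem adjoint_dilation_eq (f : BergmanSpace n m (defectSpace m T)) (x : Fin n → H)
    (hx : ∀ i, backShift i f = dilation hT hpure (x i)) :
    (dilation hT hpure).toContinuousLinearMap.adjoint f
      = defectRoot m T (normCoeff f 0) + ∑ i, T i (weightedSum m T (x i)) := by
  have h := rowOp_adjoint_gramDiagonal f
  rw [eq_sub_iff_add_eq', adjoint_rowOp_mulTuple, rowOp_apply] at h
  rw [← adjoint_dilation_constFun hT hpure]
  nth_rewrite 1 [← h]
  rw [map_add, map_sum]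
  congr 1
  refine Finset.sum_congr rfl fun i _ => ?_
  rw [mulTuple, adjoint_dilation_mulCoord]
  simp only [backShift_gramDiagonal, hx, adjoint_dilation_gramDiagonalShift]

theorem mem_orthogonal_range_dilation (f : BergmanSpace n m (defectSpace m T)) :
    f ∈ (LinearMap.range (dilation hT hpure).toLinearMap)ᗮ ↔
      (dilation hT hpure).toContinuousLinearMap.adjoint f = 0 := by
  change f ∈ (LinearMap.range (dilation hT hpure).toContinuousLinearMap.toLinearMap)ᗮ ↔ _
  rw [ContinuousLinearMap.orthogonal_range]
  rfl

theorem mem_wanderingSubspace_iff (f : BergmanSpace n m (defectSpace m T)) :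
    f ∈ wanderingSubspace (mulTuple n m (defectSpace m T))
        (LinearMap.range (dilation hT hpure).toLinearMap)ᗮ ↔
      (dilation hT hpure).toContinuousLinearMap.adjoint f = 0 ∧
        ∀ i, ∃ x, backShift i f = dilation hT hpure x := by
  have hcomplete : CompleteSpace (LinearMap.range (dilation hT hpure).toLinearMap) :=
    (dilation hT hpure).isometry.isUniformInducing.isComplete_range.completeSpace_coe
  rw [wanderingSubspace, Submodule.mem_inf, mem_orthogonal_range_dilation,
    ← Submodule.iInf_orthogonal, Submodule.mem_iInf]
  refine and_congr_right fun _ => forall_congr' fun i => ?_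
  set M := (LinearMap.range (dilation hT hpure).toLinearMap)ᗮ with hM
  have h1 : f ∈ (M.map (mulTuple n m (defectSpace m T) i).toLinearMap)ᗮ ↔ backShift i f ∈ Mᗮ := by
    rw [Submodule.mem_orthogonal, Submodule.mem_orthogonal]
    refine ⟨fun h u hu => ?_, fun h u hu => ?_⟩
    · rw [← adjoint_mulCoord, ContinuousLinearMap.adjoint_inner_right]
      exact h _ ⟨u, hu, rfl⟩
    · obtain ⟨v, hv, rfl⟩ := hu
      have := h v hv
      rwa [← adjoint_mulCoord, ContinuousLinearMap.adjoint_inner_right] at this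
  rw [h1, hM, Submodule.orthogonal_orthogonal]
  exact exists_congr fun x => eq_comm

theorem BergmanBall.IsRepresentation.toLp_eq_adjoint {j : H → BergmanSpace n m (defectSpace m T)}
    {f : BergmanSpace n m (defectSpace m T)} {f₀ : defectSpace m T} {x : Fin n → H}
    (h : IsRepresentation T j f f₀ x) :
    WithLp.toLp 2 (fun i => j (x i)) = (rowOp (mulTuple n m (defectSpace m T))).adjoint f := by
  obtain ⟨⟨hx, hf⟩, -⟩ := h
  rw [hf, map_add, adjoint_rowOp_constFun, zero_add, adjoint_rowOp_rowOp_gramInv]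

theorem BergmanBall.IsRepresentation.normCoeff_zero {j : H → BergmanSpace n m (defectSpace m T)}
    {f : BergmanSpace n m (defectSpace m T)} {f₀ : defectSpace m T} {x : Fin n → H}
    (h : IsRepresentation T j f f₀ x) : normCoeff f 0 = f₀ := by
  have h1 := h.toLp_eq_adjoint
  obtain ⟨⟨hx, hf⟩, -⟩ := h
  have h2 : (rowOp (mulTuple n m (defectSpace m T))).adjoint f
      ∈ columnRange (mulTuple n m (defectSpace m T)) := ⟨f, rfl⟩
  have h3 := (constFun_add_rowOp_gramInv f h2).trans hf
  simp only [h1, add_left_inj] at h3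
  have h4 := congrArg (fun g => normCoeff g 0) h3
  simpa [constFun, normCoeff_single] using h4

theorem mem_wanderingSubspace_iff_isRepresentation (f : BergmanSpace n m (defectSpace m T)) :
    f ∈ wanderingSubspace (mulTuple n m (defectSpace m T))
        (LinearMap.range (dilation hT hpure).toLinearMap)ᗮ ↔
      ∃ (f₀ : defectSpace m T) (x : Fin n → H),
        IsRepresentation T (dilation hT hpure) f f₀ x := by
  rw [mem_wanderingSubspace_iff]
  constructor
  · rintro ⟨h0, hx⟩
    choose x hx using hx
    have h1 : WithLp.toLp 2 (fun i => dilation hT hpure (x i))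
        = (rowOp (mulTuple n m (defectSpace m T))).adjoint f := by
      simp only [adjoint_rowOp_mulTuple, hx]
    refine ⟨normCoeff f 0, x, ⟨h1 ▸ ⟨f, rfl⟩, ?_⟩, ?_⟩
    · simp only [h1]
      exact (constFun_add_rowOp_gramInv f ⟨f, rfl⟩).symm
    · rw [← adjoint_dilation_eq hT hpure f x hx, h0]
  · rintro ⟨f₀, x, h⟩
    have hx : ∀ i, backShift i f = dilation hT hpure (x i) := fun i => by
      have := h.toLp_eq_adjoint
      rw [adjoint_rowOp_mulTuple] at this
      exact (congrArg (fun g => g.ofLp i) this).symm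
    exact ⟨by rw [adjoint_dilation_eq hT hpure f x hx, h.normCoeff_zero, h.2],
      fun i => ⟨x i, hx i⟩⟩

end Dilation

theorem mainTheorem5 {n m : ℕ} [NeZero m] {H : Type*} [NormedAddCommGroup H]
    [InnerProductSpace ℂ H] [CompleteSpace H] (T : Fin n → H →L[ℂ] H)
    (hT : IsHypercontraction m T) (hpure : IsPure T) :
    ∃ j : H →ₗᵢ[ℂ] BergmanSpace n m (defectSpace m T),
      -- `j(x)(z) = ∑ ρ_m(α) (C T^{*α} x) z^α`; this determines `j`
      IsCanonicalDilation m T j ∧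
      -- `M = (Im j)ᗮ` is invariant under the multiplication tuple
      (∀ i, ∀ f ∈ (LinearMap.range j.toLinearMap)ᗮ,
        mulTuple n m (defectSpace m T) i f ∈ (LinearMap.range j.toLinearMap)ᗮ) ∧
      -- description of the wandering subspace `W(M)`
      (∀ f : BergmanSpace n m (defectSpace m T),
        f ∈ wanderingSubspace (mulTuple n m (defectSpace m T))
            (LinearMap.range j.toLinearMap)ᗮ ↔
          ∃ (f₀ : defectSpace m T) (x : Fin n → H), IsRepresentation T j f f₀ x) ∧
      -- in every such representation, `(j x_i) = M_z^* f`
      (∀ (f : BergmanSpace n m (defectSpace m T)) (f₀ : defectSpace m T) (x : Fin n → H),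
        IsRepresentation T j f f₀ x →
          WithLp.toLp 2 (fun i => j (x i))
            = (rowOp (mulTuple n m (defectSpace m T))).adjoint f) := by
  refine ⟨dilation hT hpure, isCanonicalDilation_dilation hT hpure, fun i f hf => ?_,
    mem_wanderingSubspace_iff_isRepresentation hT hpure, fun f f₀ x h => h.toLp_eq_adjoint⟩
  rw [mem_orthogonal_range_dilation] at hf ⊢
  rw [mulTuple, adjoint_dilation_mulCoord, hf, map_zero]
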